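/- For $n\ge 0$ let $\mathfrak S_n$ be the symmetric group on $\{1,\dots,n\}$, generated by the adjacent transpositions $s_i=(i\;\,i+1)$, $1\le i\le n-1$. For $\pi\in\mathfrak S_n$ let $\ell(\pi)$ be the least $k$ such that $\pi=s_{i_1}\cdots s_{i_k}$ for some $i_1,\dots,i_k$, and let $R(\pi)$ be the set of reduced words of $\pi$, i.e. of the words $i_1\cdots i_k$ with $k=\ell(\pi)$ and $\pi=s_{i_1}\cdots s_{i_k}$. Let $G_\pi$ be the graph with vertex set $R(\pi)$ in which two words are adjacent if they differ by a commutation move (switching two adjacent letters $i,j$ with $|i-j|>1$) or by a long braid move (exchanging $j(j+1)j$ and $(j+1)j(j+1)$ on consecutive positions). Let $C_\pi$ be the simple graph obtained from $G_\pi$ by contracting all commutation edges, and $B_\pi$ the simple graph obtained from $G_\pi$ by contracting all long braid edges. All these graphs are connected; $\operatorname{diam}$ denotes the maximal distance between two vertices. Let $a\ge 0$, let $\alpha=\alpha_1\cdots\alpha_a\in\mathfrak S_a$ (in one-line notation), and let $\pi=21[\alpha,1]\in\mathfrak S_{a+1}$ be the permutation with one-line notation $(\alpha_1+1)(\alpha_2+1)\cdots(\alpha_a+1)\,1$.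 Then \begin{enumerate} \item[(i)] $\operatorname{diam}(G_\pi)=\operatorname{diam}(G_\alpha)+\ell(\alpha)(a-1)$, \item[(ii)] $\operatorname{diam}(C_\pi)=\operatorname{diam}(C_\alpha)+\ell(\alpha)$, \item[(iii)] $\operatorname{diam}(B_\pi)=\operatorname{diam}(B_\alpha)+\ell(\alpha)(a-2)$. \end{enumerate} -/

import Mathlib

namespace ReducedWords

/-- The simple reflection of `𝔖ₙ`, acting on `Fin n = {0, …, n-1}`, that interchanges `i` and
`i + 1`. It is only used for `i + 1 < n`; letters are numbered from `0`. -/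
def simpleReflection (n i : ℕ) : Equiv.Perm (Fin n) :=
  if h : i + 1 < n then Equiv.swap ⟨i, Nat.lt_of_succ_lt h⟩ ⟨i + 1, h⟩ else 1

/-- `w = i₁ i₂ ⋯ iₖ` is a word in the simple reflections of `𝔖ₙ` with
`s_{i₁} s_{i₂} ⋯ s_{iₖ} = π`. -/
def IsWordFor {n : ℕ} (π : Equiv.Perm (Fin n)) (w : List ℕ) : Prop :=
  (∀ i ∈ w, i + 1 < n) ∧ (w.map (simpleReflection n)).prod = π

/-- The set `R(π)` of reduced words for `π`: the words for `π` of minimal length. -/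
def R {n : ℕ} (π : Equiv.Perm (Fin n)) : Set (List ℕ) :=
  {w | IsWordFor π w ∧ ∀ w', IsWordFor π w' → w.length ≤ w'.length}

/-- The length `ℓ(π)`: the least number of letters of a word for `π`. -/
noncomputable def ell {n : ℕ} (π : Equiv.Perm (Fin n)) : ℕ :=
  sInf {k | ∃ w, IsWordFor π w ∧ w.length = k}

/-- A commutation move switches two adjacent letters `i`, `j` with `|i - j| > 1`. -/
def CommutationMove (w w' : List ℕ) : Prop :=
  ∃ (x y : List ℕ) (i j : ℕ), (i + 1 < j ∨ j + 1 < i) ∧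
    w = x ++ [i, j] ++ y ∧ w' = x ++ [j, i] ++ y

/-- A long braid move exchanges consecutive occurrences of `j (j+1) j` and `(j+1) j (j+1)`. -/
def LongBraidMove (w w' : List ℕ) : Prop :=
  ∃ (x y : List ℕ) (j : ℕ),
    (w = x ++ [j, j + 1, j] ++ y ∧ w' = x ++ [j + 1, j, j + 1] ++ y) ∨
    (w = x ++ [j + 1, j, j + 1] ++ y ∧ w' = x ++ [j, j + 1, j] ++ y)

/-- The graph on `R(π)` whose edges are the commutation moves. -/
def commutationEdges {n : ℕ} (π : Equiv.Perm (Fin n)) : SimpleGraph (R π) where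
  Adj u v := CommutationMove u v
  symm := ⟨by
    rintro u v ⟨x, y, i, j, h, hu, hv⟩
    exact ⟨x, y, j, i, h.symm, hv, hu⟩⟩
  loopless := ⟨by
    rintro u ⟨x, y, i, j, h, hu, hv⟩
    have := hu.symm.trans hv
    simp at this
    omega⟩

/-- The graph on `R(π)` whose edges are the long braid moves. -/
def longBraidEdges {n : ℕ} (π : Equiv.Perm (Fin n)) : SimpleGraph (R π) where
  Adj u v := LongBraidMove u v
  symm := ⟨by
    rintro u v ⟨x, y, j, ⟨hu, hv⟩ | ⟨hu, hv⟩⟩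
    · exact ⟨x, y, j, Or.inr ⟨hv, hu⟩⟩
    · exact ⟨x, y, j, Or.inl ⟨hv, hu⟩⟩⟩
  loopless := ⟨by
    rintro u ⟨x, y, j, ⟨hu, hv⟩ | ⟨hu, hv⟩⟩ <;>
    · have := hu.symm.trans hv
      simp at this⟩

/-- The graph `G_π` on `R(π)`: its edges are the commutation edges and the long braid edges. -/
def G {n : ℕ} (π : Equiv.Perm (Fin n)) : SimpleGraph (R π) :=
  commutationEdges π ⊔ longBraidEdges π

/-- The graph `C_π`: `G_π` contracted along the commutation edges. Its vertices are the commutation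
classes, and two different classes are adjacent iff an edge of `G_π` joins a member of one to a
member of the other (`SimpleGraph.map` discards loops). -/
def C {n : ℕ} (π : Equiv.Perm (Fin n)) : SimpleGraph (commutationEdges π).ConnectedComponent :=
  (G π).map (commutationEdges π).connectedComponentMk

/-- The graph `B_π`: `G_π` contracted along the long braid edges; its vertices are the braid
classes. -/
def B {n : ℕ} (π : Equiv.Perm (Fin n)) : SimpleGraph (longBraidEdges π).ConnectedComponent :=
  (G π).map (longBraidEdges π).connectedComponentMk

/-- The inflation `21[α, β]`: in one-line notation, the entries of `α` raised by `|β|`, followed by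
the entries of `β`. -/
def inflation21 {a b : ℕ} (α : Equiv.Perm (Fin a)) (β : Equiv.Perm (Fin b)) :
    Equiv.Perm (Fin (a + b)) :=
  finSumFinEquiv.symm.trans <| (Equiv.sumCongr α β).trans <|
    (Equiv.sumComm (Fin a) (Fin b)).trans <| finSumFinEquiv.trans <| finCongr (Nat.add_comm b a)

theorem inflation21_castAdd {a b : ℕ} (α : Equiv.Perm (Fin a)) (β : Equiv.Perm (Fin b))
    (i : Fin a) : (inflation21 α β (Fin.castAdd b i) : ℕ) = b + α i := by
  simp [inflation21, Nat.add_comm]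

theorem inflation21_natAdd {a b : ℕ} (α : Equiv.Perm (Fin a)) (β : Equiv.Perm (Fin b))
    (i : Fin b) : (inflation21 α β (Fin.natAdd a i) : ℕ) = β i := by
  simp [inflation21]

end ReducedWords

namespace ReducedWords

/-! Read a reduced word as a wiring diagram and follow the wire of the smallest value, `0`. Let a
commutation move cost `c` and a long braid move cost `b`. The pairs (1,1), (0,1), (1,0) give the
distances in `G`, `C`, `B`, so the single weighted statement `HasDiam.inflation` yields all three
formulas.

In a reduced word of π the wire only moves right, ending at position `a`, and erasing it leaves a
reduced word of α. Sweeping the wire over one of the ℓ(α) remaining crossings costs c(a-2)+b in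
total, so the full sweep costs W = ℓ(α)(c(a-2)+b). `wireCost` records how much of it separates a
word from the low extreme: a word at height h reaches that extreme at cost h (`MovePath.to_low`) and
the high one at cost W-h (`MovePath.to_high`).

Upper bound: let a path of cost d join the erased words. Words at heights h and h' are joined
through the low extreme at cost h+h'+d and through the high one at cost 2W-h-h'+d; the cheaper route
costs at most W+d. Lower bound: a move either acts on the erased word and keeps the height, or fixes
the erased word and changes the height by at most its own cost (`MovePath.wireErase`). Hence passing
from the low word over u to the high word over v, with u and v at maximal distance D, costs at least
D+W. -/

/-! ### Weighted paths of moves -/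

/-- `MovePath c b k u v`: the word `u` can be turned into `v` by commutation moves of cost `c` and
long braid moves of cost `b`, with total cost `k`. -/
inductive MovePath (c b : ℕ) : ℕ → List ℕ → List ℕ → Prop
  | refl (u : List ℕ) : MovePath c b 0 u u
  | comm {k : ℕ} {u v w : List ℕ} :
      MovePath c b k u v → CommutationMove v w → MovePath c b (k + c) u w
  | braid {k : ℕ} {u v w : List ℕ} :
      MovePath c b k u v → LongBraidMove v w → MovePath c b (k + b) u w

theorem CommutationMove.symm {u v : List ℕ} (h : CommutationMove u v) : CommutationMove v u := by
  obtain ⟨x, y, i, j, h, hu, hv⟩ := h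
  exact ⟨x, y, j, i, h.symm, hv, hu⟩

theorem LongBraidMove.symm {u v : List ℕ} (h : LongBraidMove u v) : LongBraidMove v u := by
  obtain ⟨x, y, j, h⟩ := h
  exact ⟨x, y, j, h.symm.imp And.symm And.symm⟩

theorem CommutationMove.append_append {u v : List ℕ} (h : CommutationMove u v) (x y : List ℕ) :
    CommutationMove (x ++ u ++ y) (x ++ v ++ y) := by
  obtain ⟨x', y', i, j, h, rfl, rfl⟩ := h
  exact ⟨x ++ x', y' ++ y, i, j, h, by simp, by simp⟩

theorem LongBraidMove.append_append {u v : List ℕ} (h : LongBraidMove u v) (x y : List ℕ) :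
    LongBraidMove (x ++ u ++ y) (x ++ v ++ y) := by
  obtain ⟨x', y', j, ⟨rfl, rfl⟩ | ⟨rfl, rfl⟩⟩ := h
  · exact ⟨x ++ x', y' ++ y, j, Or.inl ⟨by simp, by simp⟩⟩
  · exact ⟨x ++ x', y' ++ y, j, Or.inr ⟨by simp, by simp⟩⟩

theorem CommutationMove.map_succ {u v : List ℕ} (h : CommutationMove u v) :
    CommutationMove (u.map (· + 1)) (v.map (· + 1)) := by
  obtain ⟨x, y, i, j, h, rfl, rfl⟩ := h
  exact ⟨x.map (· + 1), y.map (· + 1), i + 1, j + 1, by omega, by simp, by simp⟩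

theorem LongBraidMove.map_succ {u v : List ℕ} (h : LongBraidMove u v) :
    LongBraidMove (u.map (· + 1)) (v.map (· + 1)) := by
  obtain ⟨x, y, j, ⟨rfl, rfl⟩ | ⟨rfl, rfl⟩⟩ := h
  · exact ⟨x.map (· + 1), y.map (· + 1), j + 1, Or.inl ⟨by simp, by simp⟩⟩
  · exact ⟨x.map (· + 1), y.map (· + 1), j + 1, Or.inr ⟨by simp, by simp⟩⟩

namespace MovePath

variable {c b : ℕ}

theorem cast {k k' : ℕ} {u v : List ℕ} (h : MovePath c b k u v) (hk : k = k') :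
    MovePath c b k' u v := hk ▸ h

theorem trans {k l : ℕ} {u v w : List ℕ} (h : MovePath c b k u v) (h' : MovePath c b l v w) :
    MovePath c b (k + l) u w := by
  induction h' with
  | refl => exact h
  | comm _ m ih => exact (ih h).comm m |>.cast (by omega)
  | braid _ m ih => exact (ih h).braid m |>.cast (by omega)

theorem of_comm {u v : List ℕ} (h : CommutationMove u v) : MovePath c b c u v :=
  ((refl u).comm h).cast (by omega)

theorem of_braid {u v : List ℕ} (h : LongBraidMove u v) : MovePath c b b u v :=
  ((refl u).braid h).cast (by omega)

theorem symm {k : ℕ} {u v : List ℕ} (h : MovePath c b k u v) : MovePath c b k v u := by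
  induction h with
  | refl => exact refl _
  | comm _ m ih => exact ((of_comm m.symm).trans ih).cast (by omega)
  | braid _ m ih => exact ((of_braid m.symm).trans ih).cast (by omega)

theorem append_append {k : ℕ} {u v : List ℕ} (h : MovePath c b k u v) (x y : List ℕ) :
    MovePath c b k (x ++ u ++ y) (x ++ v ++ y) := by
  induction h with
  | refl => exact refl _
  | comm _ m ih => exact ih.comm (m.append_append x y)
  | braid _ m ih => exact ih.braid (m.append_append x y)

theorem append_left {k : ℕ} {u v : List ℕ} (h : MovePath c b k u v) (x : List ℕ) :
    MovePath c b k (x ++ u) (x ++ v) := by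
  simpa using h.append_append x []

theorem append_right {k : ℕ} {u v : List ℕ} (h : MovePath c b k u v) (y : List ℕ) :
    MovePath c b k (u ++ y) (v ++ y) := by
  simpa using h.append_append [] y

theorem cons {k : ℕ} {u v : List ℕ} (h : MovePath c b k u v) (i : ℕ) :
    MovePath c b k (i :: u) (i :: v) :=
  h.append_left [i]

theorem map_succ {k : ℕ} {u v : List ℕ} (h : MovePath c b k u v) :
    MovePath c b k (u.map (· + 1)) (v.map (· + 1)) := by
  induction h with
  | refl => exact refl _
  | comm _ m ih => exact ih.comm m.map_succ
  | braid _ m ih => exact ih.braid m.map_succ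

theorem length_eq {k : ℕ} {u v : List ℕ} (h : MovePath c b k u v) : u.length = v.length := by
  induction h with
  | refl => rfl
  | comm _ m ih =>
    obtain ⟨x, y, i, j, -, rfl, rfl⟩ := m
    simpa using ih
  | braid _ m ih =>
    obtain ⟨x, y, j, ⟨rfl, rfl⟩ | ⟨rfl, rfl⟩⟩ := m <;> simpa using ih

/-- A letter that commutes with all letters of `x` can be moved across `x`. -/
theorem commute_across (x : List ℕ) (i : ℕ) (h : ∀ j ∈ x, i + 1 < j ∨ j + 1 < i) :
    MovePath c b (c * x.length) (x ++ [i]) (i :: x) := by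
  induction x with
  | nil => exact refl _
  | cons j x ih =>
    have h₁ := (ih fun l hl => h l (by simp [hl])).cons (c := c) (b := b) j
    have h₂ : CommutationMove (j :: i :: x) (i :: j :: x) :=
      ⟨[], x, j, i, (h j (by simp)).symm, by simp, by simp⟩
    exact (h₁.comm h₂).cast (by simp [Nat.mul_add])

/-- A letter beyond the increasing run moves to its front. -/
theorem run_append_of_le (s n i : ℕ) (h : s + n < i ∨ i + 1 < s) :
    MovePath c b (c * n) (List.range' s n ++ [i]) (i :: List.range' s n) :=
  (commute_across (List.range' s n) i fun j hj => by
    simp only [List.mem_range'_1] at hj; omega).cast (by simp)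

/-- A letter `i` inside an increasing run moves to its front and becomes `i + 1`. -/
theorem run_append_of_mem (s n i : ℕ) (h₁ : s ≤ i) (h₂ : i + 1 < s + n) :
    MovePath c b (c * (n - 2) + b) (List.range' s n ++ [i]) ((i + 1) :: List.range' s n) := by
  obtain ⟨m, rfl⟩ := Nat.exists_eq_add_of_le h₁
  obtain ⟨l, rfl⟩ : ∃ l, n = m + 2 + l := ⟨n - (m + 2), by omega⟩
  have e : List.range' s (m + 2 + l) =
      List.range' s m ++ [s + m, s + m + 1] ++ List.range' (s + m + 2) l := by
    rw [← List.range'_append_1, ← List.range'_append_1]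
    simp [List.range'_succ, Nat.add_assoc]
  rw [e]
  have p₁ := (run_append_of_le (c := c) (b := b) (s + m + 2) l (s + m)
    (Or.inr (by omega))).append_left (List.range' s m ++ [s + m, s + m + 1])
  have p₂ : LongBraidMove
      (List.range' s m ++ [s + m, s + m + 1, s + m] ++ List.range' (s + m + 2) l)
      (List.range' s m ++ [s + m + 1, s + m, s + m + 1] ++ List.range' (s + m + 2) l) :=
    ⟨_, _, _, Or.inl ⟨rfl, rfl⟩⟩
  have p₃ := (run_append_of_le (c := c) (b := b) s m (s + m + 1) (Or.inl (by omega))).append_right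
    ([s + m, s + m + 1] ++ List.range' (s + m + 2) l)
  have p₁' : MovePath c b (c * l)
      (List.range' s m ++ [s + m, s + m + 1] ++ List.range' (s + m + 2) l ++ [s + m])
      (List.range' s m ++ [s + m, s + m + 1, s + m] ++ List.range' (s + m + 2) l) := by
    simpa using p₁
  have p₃' : MovePath c b (c * m)
      (List.range' s m ++ [s + m + 1, s + m, s + m + 1] ++ List.range' (s + m + 2) l)
      ((s + m + 1) :: (List.range' s m ++ [s + m, s + m + 1] ++ List.range' (s + m + 2) l)) := by
    simpa using p₃
  refine ((p₁'.braid p₂).trans p₃').cast ?_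
  rw [show m + 2 + l - 2 = m + l by omega]; ring

end MovePath

/-! ### Following the wire of the smallest value -/

/-- The position of the wire after the letter `i`, if it was at position `q` before. -/
def wireStep (q i : ℕ) : ℕ := if i = q then q + 1 else if i + 1 = q then q - 1 else q

/-- The position of the wire after the word `w`, if it was at position `q` before. -/
def wirePos : ℕ → List ℕ → ℕ
  | q, [] => q
  | q, i :: w => wirePos (wireStep q i) w

/-- The word obtained by deleting the wire that starts at position `q`. -/
def wireErase : ℕ → List ℕ → List ℕ
  | _, [] => []
  | q, i :: w => (if q < i then [i - 1] else if i + 1 < q then [i] else []) ++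
      wireErase (wireStep q i) w

/-- The number of times that the wire starting at position `q` moves to the left. -/
def wireBack : ℕ → List ℕ → ℕ
  | _, [] => 0
  | q, i :: w => (if i + 1 = q then 1 else 0) + wireBack (wireStep q i) w

/-- The cost of moving the wire that starts at position `q` to the far end of all crossings
of the other wires. -/
def wireCost (c b : ℕ) : ℕ → List ℕ → ℕ
  | _, [] => 0
  | q, i :: w => (if q < i then c * q else if i + 1 < q then c * (q - 2) + b else 0) +
      wireCost c b (wireStep q i) w

theorem wirePos_append (q : ℕ) (u v : List ℕ) :
    wirePos q (u ++ v) = wirePos (wirePos q u) v := by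
  induction u generalizing q with
  | nil => rfl
  | cons i u ih => simp [wirePos, ih]

theorem wireErase_append (q : ℕ) (u v : List ℕ) :
    wireErase q (u ++ v) = wireErase q u ++ wireErase (wirePos q u) v := by
  induction u generalizing q with
  | nil => rfl
  | cons i u ih => simp [wirePos, wireErase, ih]

theorem wireCost_append (c b q : ℕ) (u v : List ℕ) :
    wireCost c b q (u ++ v) = wireCost c b q u + wireCost c b (wirePos q u) v := by
  induction u generalizing q with
  | nil => simp [wireCost, wirePos]
  | cons i u ih => simp [wirePos, wireCost, ih, Nat.add_assoc]

/-- Each letter survives the erasure, moves the wire right, or moves it left; a left step has to be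
made up by a right step, hence the factor 2. This count is what forbids left steps in reduced words.
-/
theorem wire_length (q : ℕ) (w : List ℕ) :
    w.length + q = (wireErase q w).length + wirePos q w + 2 * wireBack q w := by
  induction w generalizing q with
  | nil => simp [wireErase, wirePos, wireBack]
  | cons i w ih =>
    have := ih (wireStep q i)
    simp only [wireErase, wirePos, wireBack, List.length_append, List.length_cons]
    unfold wireStep at *
    split_ifs at * <;> simp <;> omega

theorem wireStep_of_lt {q i : ℕ} (h : q < i) : wireStep q i = q := by
  unfold wireStep; split_ifs <;> omega

theorem wireStep_of_gt {q i : ℕ} (h : i + 1 < q) : wireStep q i = q := by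
  unfold wireStep; split_ifs <;> omega

theorem wireStep_self (i : ℕ) : wireStep i i = i + 1 := by simp [wireStep]

theorem wireStep_succ (i : ℕ) : wireStep (i + 1) i = i := by simp [wireStep]

/-- If neither letter moves the wire, both survive and still commute. Otherwise exactly one does,
and the other crossing sees the wire displaced by one position, which changes its cost by `c`. One
inequality suffices because `i` and `j` play symmetric roles. -/
theorem wire_commutation_local (c b q i j : ℕ) (h : i + 1 < j ∨ j + 1 < i) :
    wirePos q [i, j] = wirePos q [j, i] ∧
    ((CommutationMove (wireErase q [i, j]) (wireErase q [j, i]) ∧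
        wireCost c b q [j, i] = wireCost c b q [i, j]) ∨
      (wireErase q [i, j] = wireErase q [j, i] ∧
        wireCost c b q [j, i] ≤ wireCost c b q [i, j] + c)) := by
  have key : ∀ k l : ℕ, (k + 1 < l ∨ l + 1 < k) → CommutationMove [k, l] [l, k] :=
    fun k l h => ⟨[], [], k, l, h, by simp, by simp⟩
  simp only [wirePos, wireErase, wireCost]
  have e₁ : ∀ n, c * (n + 1) = c * n + c := fun n => by ring
  obtain hi | rfl | rfl | hi : q < i ∨ q = i ∨ q = i + 1 ∨ i + 1 < q := by omega
  · obtain hj | rfl | rfl | hj : q < j ∨ q = j ∨ q = j + 1 ∨ j + 1 < q := by omega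
    · simp only [wireStep_of_lt, hi, hj, if_true, true_and]
      exact Or.inl ⟨key _ _ (by omega), trivial⟩
    · have h' : q + 1 < i := by omega
      simp [wireStep_of_lt, wireStep_self, hi, h', e₁]
    · have h' : j < i := by omega
      simp [wireStep_of_lt, wireStep_succ, hi, h', e₁]; omega
    · have n₂ : ¬ q < j := by omega
      simp only [wireStep_of_lt, wireStep_of_gt, hi, hj, n₂, if_true, if_false, true_and]
      exact Or.inl ⟨key _ _ (by omega), by ring⟩
  · obtain hj | hj : q + 1 < j ∨ j + 1 < q := by omega
    · have h' : q < j := by omega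
      simp [wireStep_of_lt, wireStep_self, hj, h', e₁]; omega
    · have h' : ¬ q < j := by omega
      have h'' : ¬ q + 1 < j := by omega
      have h₃ : j + 1 < q + 1 := by omega
      -- A crossing below the wire forces `q ≥ 2`, so the truncated `q - 2` is exact.
      obtain ⟨m, rfl⟩ : ∃ m, q = m + 2 := ⟨q - 2, by omega⟩
      simp only [wireStep_of_gt hj, wireStep_of_gt h₃, wireStep_self, hj, h', h'', h₃]
      simp [show m + 2 + 1 - 2 = m + 1 by omega, e₁]; omega
  · obtain hj | hj : i + 1 < j ∨ j + 1 < i := by omega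
    · have h' : i < j := by omega
      simp [wireStep_of_lt, wireStep_succ, hj, h', e₁]
    · have h' : ¬ i < j := by omega
      have h'' : ¬ i + 1 < j := by omega
      have h₃ : j + 1 < i + 1 := by omega
      obtain ⟨m, rfl⟩ : ∃ m, i = m + 2 := ⟨i - 2, by omega⟩
      simp only [wireStep_of_gt hj, wireStep_of_gt h₃, wireStep_succ, hj, h', h'', h₃]
      simp [show m + 2 + 1 - 2 = m + 1 by omega, e₁]; omega
  · have n₁ : ¬ q < i := by omega
    obtain hj | rfl | rfl | hj : q < j ∨ q = j ∨ q = j + 1 ∨ j + 1 < q := by omega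
    · simp only [wireStep_of_lt, wireStep_of_gt, hi, hj, n₁, if_true, if_false, true_and]
      exact Or.inl ⟨key _ _ (by omega), by ring⟩
    · have h' : ¬ q + 1 < i := by omega
      have h₃ : i + 1 < q + 1 := by omega
      obtain ⟨m, rfl⟩ : ∃ m, q = m + 2 := ⟨q - 2, by omega⟩
      simp only [wireStep_of_gt hi, wireStep_of_gt h₃, wireStep_self, hi, h', n₁, h₃]
      simp [show m + 2 + 1 - 2 = m + 1 by omega, e₁]; omega
    · have h' : ¬ j < i := by omega
      have h₃ : i + 1 < j := by omega
      obtain ⟨m, rfl⟩ : ∃ m, j = m + 2 := ⟨j - 2, by omega⟩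
      simp only [wireStep_of_gt hi, wireStep_of_gt h₃, wireStep_succ, hi, h', n₁, h₃]
      simp [show m + 2 + 1 - 2 = m + 1 by omega, e₁]; omega
    · have n₂ : ¬ q < j := by omega
      simp only [wireStep_of_gt, hi, hj, n₁, n₂, if_true, if_false, true_and]
      exact Or.inl ⟨key _ _ (by omega), trivial⟩

/-- If the wire is one of the three strands, both words contain exactly one crossing of the other
two, and the move carries the wire across it: its cost is `c * j` on one side and `c * j + b` on the
other. If not, the braid survives the erasure. -/
theorem wire_braid_local (c b q j : ℕ) :
    wirePos q [j, j + 1, j] = wirePos q [j + 1, j, j + 1] ∧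
    ((LongBraidMove (wireErase q [j, j + 1, j]) (wireErase q [j + 1, j, j + 1]) ∧
        wireCost c b q [j, j + 1, j] = wireCost c b q [j + 1, j, j + 1]) ∨
      (wireErase q [j, j + 1, j] = wireErase q [j + 1, j, j + 1] ∧
        wireCost c b q [j, j + 1, j] ≤ wireCost c b q [j + 1, j, j + 1] + b ∧
        wireCost c b q [j + 1, j, j + 1] ≤ wireCost c b q [j, j + 1, j] + b)) := by
  have key : ∀ k : ℕ, LongBraidMove [k, k + 1, k] [k + 1, k, k + 1] :=
    fun k => ⟨[], [], k, Or.inl ⟨by simp, by simp⟩⟩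
  simp only [wirePos, wireErase, wireCost]
  obtain hq | rfl | rfl | rfl | hq :
    q < j ∨ q = j ∨ q = j + 1 ∨ q = j + 2 ∨ j + 2 < q := by omega
  · have h' : q < j + 1 := by omega
    simp only [wireStep_of_lt, hq, h', if_true, true_and]
    obtain ⟨m, rfl⟩ : ∃ m, j = m + 1 := ⟨j - 1, by omega⟩
    exact Or.inl ⟨key m, trivial⟩
  · have n : ¬ q + 1 + 1 < q := by omega
    simp [wireStep_self, wireStep_of_lt, wireStep_of_gt, n]
    omega
  · have n : ¬ j + 1 + 1 < j := by omega
    simp [wireStep_self, wireStep_succ, wireStep_of_lt, wireStep_of_gt, n]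
    omega
  · simp [wireStep_succ, wireStep_of_lt, wireStep_of_gt]
    omega
  · have h₁ : ¬ q < j := by omega
    have h₂ : ¬ q < j + 1 := by omega
    have h₃ : j + 1 < q := by omega
    have h₄ : j + 1 + 1 < q := by omega
    simp only [wireStep_of_gt, h₁, h₂, h₃, h₄, if_true, if_false, true_and]
    exact Or.inl ⟨key j, trivial⟩

theorem wire_of_commutationMove (c b q : ℕ) {w w' : List ℕ} (h : CommutationMove w w') :
    (CommutationMove (wireErase q w) (wireErase q w') ∧ wireCost c b q w' = wireCost c b q w) ∨
      (wireErase q w = wireErase q w' ∧ wireCost c b q w' ≤ wireCost c b q w + c) := by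
  obtain ⟨x, y, i, j, h, rfl, rfl⟩ := h
  obtain ⟨h₁, h₂⟩ := wire_commutation_local c b (wirePos q x) i j h
  simp only [wireErase_append, wireCost_append, wirePos_append, h₁]
  rcases h₂ with ⟨h₂, h₃⟩ | ⟨h₂, h₃⟩
  · exact Or.inl ⟨h₂.append_append _ _, by omega⟩
  · exact Or.inr ⟨by rw [h₂], by omega⟩

theorem wire_of_longBraidMove (c b q : ℕ) {w w' : List ℕ} (h : LongBraidMove w w') :
    (LongBraidMove (wireErase q w) (wireErase q w') ∧ wireCost c b q w' = wireCost c b q w) ∨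
      (wireErase q w = wireErase q w' ∧ wireCost c b q w' ≤ wireCost c b q w + b) := by
  obtain ⟨x, y, j, ⟨rfl, rfl⟩ | ⟨rfl, rfl⟩⟩ := h <;>
  obtain ⟨h₁, h₂⟩ := wire_braid_local c b (wirePos q x) j <;>
  simp only [wireErase_append, wireCost_append, wirePos_append, h₁] <;>
  rcases h₂ with ⟨h₂, h₃⟩ | ⟨h₂, h₃, h₄⟩
  · exact Or.inl ⟨h₂.append_append _ _, by omega⟩
  · exact Or.inr ⟨by rw [h₂], by omega⟩
  · exact Or.inl ⟨h₂.symm.append_append _ _, by omega⟩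
  · exact Or.inr ⟨by rw [h₂], by omega⟩

/-- Deleting the wire shortens a path by at least the difference of the wire costs. -/
theorem MovePath.wireErase {c b k : ℕ} {w w' : List ℕ} (h : MovePath c b k w w') (q : ℕ) :
    ∃ l, MovePath c b l (wireErase q w) (wireErase q w') ∧
      l + wireCost c b q w' ≤ k + wireCost c b q w := by
  induction h with
  | refl => exact ⟨0, refl _, le_rfl⟩
  | comm _ m ih =>
    obtain ⟨l, hl, hl'⟩ := ih
    rcases wire_of_commutationMove c b q m with ⟨h₁, h₂⟩ | ⟨h₁, h₂⟩
    · exact ⟨_, hl.comm h₁, by omega⟩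
    · exact ⟨l, h₁ ▸ hl, by omega⟩
  | braid _ m ih =>
    obtain ⟨l, hl, hl'⟩ := ih
    rcases wire_of_longBraidMove c b q m with ⟨h₁, h₂⟩ | ⟨h₁, h₂⟩
    · exact ⟨_, hl.braid h₁, by omega⟩
    · exact ⟨l, h₁ ▸ hl, by omega⟩

/-! ### Moving the wire to the two extreme positions -/

/-- The wire starting at `q` can be moved behind all other letters at cost `wireCost c b q w`. -/
theorem MovePath.to_low (c b q : ℕ) (w : List ℕ) (h : wireBack q w = 0) :
    MovePath c b (wireCost c b q w) (List.range' 0 q ++ w)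
      ((ReducedWords.wireErase q w).map (· + 1) ++ List.range' 0 (wirePos q w)) := by
  induction w generalizing q with
  | nil => simpa [wireCost, ReducedWords.wireErase, wirePos] using refl _
  | cons i w ih =>
    simp only [wireBack, Nat.add_eq_zero_iff] at h
    have ih := ih _ h.2
    obtain hi | rfl | rfl | hi : q < i ∨ q = i ∨ q = i + 1 ∨ i + 1 < q := by omega
    · rw [wireStep_of_lt hi] at ih
      have p := (run_append_of_le (c := c) (b := b) 0 q i (Or.inl (by omega))).append_right w
      simpa [wireCost, ReducedWords.wireErase, wirePos, wireStep_of_lt hi, hi,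
        Nat.sub_add_cancel (show 1 ≤ i by omega)] using
        p.trans (ih.cons i)
    · rw [wireStep_self, List.range'_1_concat] at ih
      simpa [wireCost, ReducedWords.wireErase, wirePos, wireStep_self] using ih
    -- The wire would step back, which `wireBack` being zero excludes.
    · simp at h
    · have n : ¬ q < i := by omega
      rw [wireStep_of_gt hi] at ih
      have p := (run_append_of_mem (c := c) (b := b) 0 q i (by omega) (by omega)).append_right w
      simpa [wireCost, ReducedWords.wireErase, wirePos, wireStep_of_gt hi, hi, n] using
        p.trans (ih.cons (i + 1))

theorem le_wirePos (q : ℕ) (w : List ℕ) (h : wireBack q w = 0) : q ≤ wirePos q w := by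
  induction w generalizing q with
  | nil => exact le_rfl
  | cons i w ih =>
    simp only [wireBack, Nat.add_eq_zero_iff] at h
    refine le_trans ?_ (ih _ h.2)
    have := h.1
    unfold wireStep
    split_ifs at this ⊢ <;> omega

/-- If the wire ends at the last position `a`, it can be moved in front of all other letters. -/
theorem MovePath.to_high (c b q a : ℕ) (w : List ℕ) (hw : ∀ i ∈ w, i < a)
    (h : wireBack q w = 0) (ha : wirePos q w = a) :
    ∃ k, MovePath c b k w (List.range' q (a - q) ++ ReducedWords.wireErase q w) ∧
      k + wireCost c b q w = (ReducedWords.wireErase q w).length * (c * (a - 2) + b) := by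
  induction w generalizing q with
  | nil =>
    have : q = a := ha
    subst this
    exact ⟨0, by simpa [ReducedWords.wireErase] using refl _,
      by simp [ReducedWords.wireErase, wireCost]⟩
  | cons i w ih =>
    have hqa : q ≤ a := ha ▸ le_wirePos q _ h
    have hia : i < a := hw i (by simp)
    simp only [wireBack, Nat.add_eq_zero_iff] at h
    obtain ⟨k, hk, hk'⟩ := ih _ (fun j hj => hw j (by simp [hj])) h.2 ha
    obtain hi | rfl | rfl | hi : q < i ∨ q = i ∨ q = i + 1 ∨ i + 1 < q := by omega
    · rw [wireStep_of_lt hi] at hk hk'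
      obtain ⟨j, rfl⟩ : ∃ j, i = j + 1 := ⟨i - 1, by omega⟩
      have p := (run_append_of_mem (c := c) (b := b) q (a - q) j
        (by omega) (by omega)).symm.append_right (ReducedWords.wireErase q w)
      refine ⟨_, by simpa [ReducedWords.wireErase, wireStep_of_lt hi, hi] using
        (hk.cons (j + 1)).trans p, ?_⟩
      simp only [ReducedWords.wireErase, wireCost, wireStep_of_lt hi, hi, if_true,
        List.length_append, List.length_singleton, Nat.add_mul, ← hk']
      -- The crossing costs `c * q` towards the low extreme and `c * (a - q - 2) + b` towards the
      -- high one; the sum is independent of `q`.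
      rw [show a - 2 = (a - q - 2) + q by omega]
      ring
    · rw [wireStep_self] at hk hk'
      refine ⟨k, ?_, by simpa [ReducedWords.wireErase, wireCost, wireStep_self] using hk'⟩
      rw [show a - q = (a - (q + 1)) + 1 by omega, List.range'_succ]
      simpa [ReducedWords.wireErase, wireStep_self] using hk.cons q
    · simp at h
    · have n : ¬ q < i := by omega
      rw [wireStep_of_gt hi] at hk hk'
      have p := (run_append_of_le (c := c) (b := b) q (a - q) i (Or.inr hi)).symm.append_right
        (ReducedWords.wireErase q w)
      refine ⟨_, by simpa [ReducedWords.wireErase, wireStep_of_gt hi, hi, n] using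
        (hk.cons i).trans p, ?_⟩
      simp only [ReducedWords.wireErase, wireCost, wireStep_of_gt hi, hi, n, if_true, if_false,
        List.length_append, List.length_singleton, Nat.add_mul, ← hk']
      rw [show a - 2 = (a - q) + (q - 2) by omega]
      ring

/-- The wire stays at position 0, where every shifted letter costs `c * 0`, and the final run
consists of crossings of the wire itself. -/
theorem wire_low (c b m : ℕ) (u : List ℕ) :
    wireErase 0 (u.map (· + 1) ++ List.range' 0 m) = u ∧
      wireCost c b 0 (u.map (· + 1) ++ List.range' 0 m) = 0 := by
  have run : ∀ n s, wireErase s (List.range' s n) = [] ∧ wireCost c b s (List.range' s n) = 0 := by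
    intro n
    induction n with
    | zero => intro s; simp [wireErase, wireCost]
    | succ n ih => intro s; simp [List.range'_succ, wireErase, wireCost, wireStep_self, ih]
  induction u with
  | nil => simpa using run m 0
  | cons i u ih =>
    simp [wireErase, wireCost, wireStep_of_lt (Nat.succ_pos i)] at ih ⊢
    exact ih

theorem wire_high (c b a : ℕ) (u : List ℕ) (hu : ∀ i ∈ u, i + 1 < a) :
    wireErase a u = u ∧ wireBack a u = 0 ∧ wirePos a u = a ∧
      wireCost c b a u = u.length * (c * (a - 2) + b) := by
  induction u with
  | nil => simp [wireErase, wireBack, wirePos, wireCost]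
  | cons i u ih =>
    have hi : i + 1 < a := hu i (by simp)
    have n : ¬ a < i := by omega
    obtain ⟨h₁, h₂, h₃, h₄⟩ := ih fun j hj => hu j (by simp [hj])
    refine ⟨?_, ?_, ?_, ?_⟩
    · simp [wireErase, wireStep_of_gt hi, hi, n, h₁]
    · simp [wireBack, wireStep_of_gt hi, hi.ne, h₂]
    · simp [wirePos, wireStep_of_gt hi, h₃]
    · simp [wireCost, wireStep_of_gt hi, hi, n, h₄]; ring

theorem wire_run_append (c b s n : ℕ) (u : List ℕ) :
    wireErase s (List.range' s n ++ u) = wireErase (s + n) u ∧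
      wireCost c b s (List.range' s n ++ u) = wireCost c b (s + n) u := by
  induction n generalizing s with
  | zero => simp
  | succ n ih =>
    have := ih (s + 1)
    simp [List.range'_succ, wireErase, wireCost, wireStep_self, this]
    rw [show s + 1 + n = s + (n + 1) by omega]
    exact ⟨rfl, rfl⟩

/-! ### Words and permutations -/

/-- The product of the simple reflections of `𝔖ₙ` named by the letters of a word. -/
def wordProd (n : ℕ) (w : List ℕ) : Equiv.Perm (Fin n) := (w.map (simpleReflection n)).prod

@[simp] theorem wordProd_nil (n : ℕ) : wordProd n [] = 1 := rfl

@[simp] theorem wordProd_cons (n i : ℕ) (w : List ℕ) :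
    wordProd n (i :: w) = simpleReflection n i * wordProd n w := by
  simp [wordProd]

@[simp] theorem wordProd_append (n : ℕ) (u v : List ℕ) :
    wordProd n (u ++ v) = wordProd n u * wordProd n v := by
  simp [wordProd]

theorem simpleReflection_val {n i : ℕ} (h : i + 1 < n) (x : Fin n) :
    (simpleReflection n i x : ℕ) =
      if (x : ℕ) = i then i + 1 else if (x : ℕ) = i + 1 then i else x := by
  simp only [simpleReflection, h, dif_pos, Equiv.swap_apply_def, Fin.ext_iff]
  split_ifs <;> simp

theorem simpleReflection_mul_self (n i : ℕ) :
    simpleReflection n i * simpleReflection n i = 1 := by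
  unfold simpleReflection
  split_ifs <;> simp

theorem simpleReflection_comm {n i j : ℕ} (hi : i + 1 < n) (hj : j + 1 < n)
    (h : i + 1 < j ∨ j + 1 < i) :
    simpleReflection n i * simpleReflection n j = simpleReflection n j * simpleReflection n i := by
  ext x
  simp only [Equiv.Perm.mul_apply, simpleReflection_val hi, simpleReflection_val hj]
  split_ifs <;> omega

theorem simpleReflection_braid {n j : ℕ} (h : j + 2 < n) :
    simpleReflection n j * (simpleReflection n (j + 1) * simpleReflection n j) =
      simpleReflection n (j + 1) * (simpleReflection n j * simpleReflection n (j + 1)) := by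
  have hj : j + 1 < n := by omega
  have hj' : j + 1 + 1 < n := h
  ext x
  simp only [Equiv.Perm.mul_apply, simpleReflection_val hj, simpleReflection_val hj']
  split_ifs <;> omega

theorem CommutationMove.isWordFor {n : ℕ} {π : Equiv.Perm (Fin n)} {u v : List ℕ}
    (h : CommutationMove u v) (hu : IsWordFor π u) : IsWordFor π v := by
  obtain ⟨x, y, i, j, h, rfl, rfl⟩ := h
  obtain ⟨hl, hp⟩ := hu
  refine ⟨fun l hl' => hl l ?_, ?_⟩
  · simp only [List.mem_append, List.mem_cons] at hl' ⊢; tauto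
  · change wordProd n _ = π at hp
    change wordProd n _ = π
    rw [← hp]
    have := congrArg (· * wordProd n y)
      (simpleReflection_comm (hl i (by simp)) (hl j (by simp)) h)
    simpa [mul_assoc] using this.symm

theorem LongBraidMove.isWordFor {n : ℕ} {π : Equiv.Perm (Fin n)} {u v : List ℕ}
    (h : LongBraidMove u v) (hu : IsWordFor π u) : IsWordFor π v := by
  obtain ⟨hl, hp⟩ := hu
  change wordProd n _ = π at hp
  obtain ⟨x, y, j, ⟨rfl, rfl⟩ | ⟨rfl, rfl⟩⟩ := h
  all_goals
    refine ⟨fun l hl' => hl l ?_, ?_⟩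
    · simp only [List.mem_append, List.mem_cons] at hl' ⊢; tauto
    · change wordProd n _ = π
      rw [← hp]
      have := congrArg (· * wordProd n y) (simpleReflection_braid (hl (j + 1) (by simp)))
      first
      | simpa [mul_assoc] using this
      | simpa [mul_assoc] using this.symm

theorem MovePath.isWordFor {c b k n : ℕ} {π : Equiv.Perm (Fin n)} {u v : List ℕ}
    (h : MovePath c b k u v) (hu : IsWordFor π u) : IsWordFor π v := by
  induction h with
  | refl => exact hu
  | comm _ m ih => exact m.isWordFor (ih hu)
  | braid _ m ih => exact m.isWordFor (ih hu)

theorem MovePath.mem_R {c b k n : ℕ} {π : Equiv.Perm (Fin n)} {u v : List ℕ}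
    (h : MovePath c b k u v) (hu : u ∈ R π) : v ∈ R π :=
  ⟨h.isWordFor hu.1, fun w hw => h.length_eq ▸ hu.2 w hw⟩

theorem MovePath.wordProd_eq {c b k n : ℕ} {u v : List ℕ} (h : MovePath c b k u v)
    (hu : ∀ i ∈ u, i + 1 < n) : wordProd n u = wordProd n v :=
  (h.isWordFor (π := wordProd n u) ⟨hu, rfl⟩).2.symm

/-! ### Permutations fixing 0, and the inflation as a product -/

/-- The embedding `𝔖ₐ → 𝔖ₐ₊₁` onto the permutations that fix `0`. -/
noncomputable def shiftHom (a : ℕ) : Equiv.Perm (Fin a) →* Equiv.Perm (Fin (a + 1)) :=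
  Equiv.Perm.viaEmbeddingHom (Fin.succEmb a)

theorem shiftHom_injective (a : ℕ) : Function.Injective (shiftHom a) :=
  Equiv.Perm.viaEmbeddingHom_injective _

theorem shiftHom_succ {a : ℕ} (α : Equiv.Perm (Fin a)) (x : Fin a) :
    shiftHom a α x.succ = (α x).succ :=
  Equiv.Perm.viaEmbedding_apply α (Fin.succEmb a) x

theorem shiftHom_zero {a : ℕ} (α : Equiv.Perm (Fin a)) : shiftHom a α 0 = 0 :=
  Equiv.Perm.viaEmbedding_apply_of_notMem α (Fin.succEmb a) 0 (by simp)

theorem shiftHom_simpleReflection {a i : ℕ} (h : i + 1 < a) :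
    shiftHom a (simpleReflection a i) = simpleReflection (a + 1) (i + 1) := by
  have h' : i + 1 + 1 < a + 1 := by omega
  ext x
  rw [simpleReflection_val h']
  refine Fin.cases ?_ (fun y => ?_) x
  · simp [shiftHom_zero]
  · rw [shiftHom_succ, Fin.val_succ, simpleReflection_val h, Fin.val_succ]
    split_ifs <;> omega

theorem shiftHom_wordProd {a : ℕ} {u : List ℕ} (h : ∀ i ∈ u, i + 1 < a) :
    shiftHom a (wordProd a u) = wordProd (a + 1) (u.map (· + 1)) := by
  induction u with
  | nil => simp
  | cons i u ih =>
    simp [shiftHom_simpleReflection (h i (by simp)), ih fun j hj => h j (by simp [hj])]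

theorem wordProd_run_val {n m : ℕ} (h : m < n) (x : Fin n) :
    (wordProd n (List.range' 0 m) x : ℕ) =
      if (x : ℕ) < m then (x : ℕ) + 1 else if (x : ℕ) = m then 0 else x := by
  induction m generalizing x with
  | zero => simp
  | succ m ih =>
    rw [List.range'_1_concat, wordProd_append, Equiv.Perm.mul_apply, ih (by omega)]
    simp only [Nat.zero_add, wordProd_cons, wordProd_nil, mul_one, simpleReflection_val h]
    split_ifs <;> omega

/-- The run is the cycle taking `x` to `x + 1` and the last position to `0`; the shifted α then acts
on the nonzero values. -/
theorem inflation21_one_eq {a : ℕ} (α : Equiv.Perm (Fin a)) :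
    inflation21 α (1 : Equiv.Perm (Fin 1)) =
      shiftHom a α * wordProd (a + 1) (List.range' 0 a) := by
  ext x
  rw [Equiv.Perm.mul_apply]
  refine Fin.addCases (fun y => ?_) (fun y => ?_) x
  · have : wordProd (a + 1) (List.range' 0 a) (Fin.castAdd 1 y) = y.succ := by
      ext; rw [wordProd_run_val (by omega)]; simp
    rw [this, shiftHom_succ, inflation21_castAdd, Fin.val_succ, Nat.add_comm]
  · have : wordProd (a + 1) (List.range' 0 a) (Fin.natAdd a y) = 0 := by
      ext; rw [wordProd_run_val (by omega)]; simp
    rw [this, shiftHom_zero, inflation21_natAdd]; simp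

theorem wirePos_le {a q : ℕ} {w : List ℕ} (hq : q ≤ a) (hw : ∀ i ∈ w, i < a) :
    wirePos q w ≤ a := by
  induction w generalizing q with
  | nil => exact hq
  | cons i w ih =>
    refine ih ?_ fun j hj => hw j (by simp [hj])
    have := hw i (by simp)
    unfold wireStep
    split_ifs <;> omega

theorem lt_of_mem_wireErase {a q : ℕ} {w : List ℕ} (hq : q ≤ a) (hw : ∀ i ∈ w, i < a) :
    ∀ i ∈ wireErase q w, i + 1 < a := by
  induction w generalizing q with
  | nil => simp [wireErase]
  | cons i w ih =>
    have hi := hw i (by simp)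
    have hq' : wireStep q i ≤ a := by
      unfold wireStep
      split_ifs <;> omega
    have ih := ih hq' fun j hj => hw j (by simp [hj])
    intro l hl
    simp only [wireErase, List.mem_append] at hl
    rcases hl with hl | hl
    · split_ifs at hl <;> simp at hl <;> omega
    · exact ih l hl

/-- The wire of the value `0` can be pulled to the end of a word. -/
theorem wordProd_wire {a q : ℕ} {w : List ℕ} (hq : q ≤ a) (hw : ∀ i ∈ w, i < a) :
    wordProd (a + 1) (List.range' 0 q ++ w) =
      shiftHom a (wordProd a (wireErase q w)) *
        wordProd (a + 1) (List.range' 0 (wirePos q w)) := by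
  induction w generalizing q with
  | nil => simp [wireErase, wirePos]
  | cons i w ih =>
    have hia := hw i (by simp)
    have hw' : ∀ j ∈ w, j < a := fun j hj => hw j (by simp [hj])
    have hr : ∀ j ∈ List.range' 0 q ++ [i], j + 1 < a + 1 := by
      simp only [List.mem_append, List.mem_range'_1, List.mem_singleton]
      rintro j (hj | rfl) <;> omega
    rw [List.append_cons, wordProd_append]
    simp only [wireErase, wirePos]
    obtain hi | rfl | rfl | hi : q < i ∨ q = i ∨ q = i + 1 ∨ i + 1 < q := by omega
    · have ih := ih hq hw'
      obtain ⟨j, rfl⟩ : ∃ j, i = j + 1 := ⟨i - 1, by omega⟩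
      -- Costs are irrelevant here: the path only serves to equate two products.
      rw [(MovePath.run_append_of_le (c := 0) (b := 0) 0 q (j + 1) (by omega)).wordProd_eq hr]
      simp only [wireStep_of_lt hi, hi, wordProd_cons, mul_assoc, ← wordProd_append, ih]
      simp [shiftHom_simpleReflection (show j + 1 < a by omega), mul_assoc]
    · have ih := ih (q := q + 1) (by omega) hw'
      rw [List.range'_1_concat, wordProd_append, Nat.zero_add] at ih
      simpa [wireStep_self] using ih
    · have ih := ih (q := i) (by omega) hw'
      rw [wordProd_append] at ih
      -- The wire steps back, so `i` cancels against the last letter of the run.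
      simp [List.range'_1_concat, wireStep_succ, ← ih,
        simpleReflection_mul_self]
    · have ih := ih hq hw'
      have n : ¬ q < i := by omega
      rw [(MovePath.run_append_of_mem (c := 0) (b := 0) 0 q i (by omega) (by omega)).wordProd_eq hr]
      simp only [wireStep_of_gt hi, hi, n, wordProd_cons, mul_assoc, ← wordProd_append, ih]
      simp [shiftHom_simpleReflection (show i + 1 < a by omega), mul_assoc]

/-! ### Reduced words -/

theorem exists_isWordFor {n : ℕ} (π : Equiv.Perm (Fin n)) : ∃ w, IsWordFor π w := by
  obtain _ | n := n
  · exact ⟨[], by simp, Subsingleton.elim _ _⟩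
  have hπ : π ∈ Submonoid.closure
      (Set.range fun i : Fin n => Equiv.swap i.castSucc i.succ) := by
    rw [Equiv.Perm.mclosure_swap_castSucc_succ]; trivial
  induction hπ using Submonoid.closure_induction with
  | mem x hx =>
    obtain ⟨i, rfl⟩ := hx
    refine ⟨[i], by simp, ?_⟩
    simp only [List.map_cons, List.map_nil, List.prod_singleton]
    rw [simpleReflection, dif_pos (by omega)]
    rfl
  | one => exact ⟨[], by simp, rfl⟩
  | mul x y _ _ hx hy =>
    obtain ⟨u, hu, rfl⟩ := hx
    obtain ⟨v, hv, rfl⟩ := hy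
    exact ⟨u ++ v, fun i hi => (List.mem_append.mp hi).elim (hu i) (hv i), by simp⟩

theorem exists_mem_R {n : ℕ} (π : Equiv.Perm (Fin n)) : ∃ w, w ∈ R π := by
  have h : ∃ k, ∃ w, IsWordFor π w ∧ w.length = k :=
    (exists_isWordFor π).elim fun w hw => ⟨_, w, hw, rfl⟩
  classical
  obtain ⟨w, hw, hl⟩ := Nat.find_spec h
  exact ⟨w, hw, fun w' hw' => hl ▸ Nat.find_min' h ⟨w', hw', rfl⟩⟩

theorem length_eq_ell {n : ℕ} {π : Equiv.Perm (Fin n)} {w : List ℕ} (hw : w ∈ R π) :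
    w.length = ell π := by
  refine le_antisymm ?_ (Nat.sInf_le ⟨w, hw.1, rfl⟩)
  obtain ⟨w', hw', hl⟩ := Nat.sInf_mem (s := {k | ∃ w, IsWordFor π w ∧ w.length = k})
    ⟨_, w, hw.1, rfl⟩
  exact (hw.2 w' hw').trans_eq hl

theorem finite_R {n : ℕ} (π : Equiv.Perm (Fin n)) : (R π).Finite := by
  refine ((List.finite_length_eq (Fin n) (ell π)).image (List.map Fin.val)).subset ?_
  intro w hw
  have h : ∀ i ∈ w, i < n := fun i hi => Nat.lt_of_succ_lt (hw.1.1 i hi)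
  refine ⟨w.pmap (fun i hi => ⟨i, hi⟩) h, ?_, ?_⟩
  · simp [length_eq_ell hw]
  · simp [List.map_pmap]

/-- Deleting the wire of `0` from a word for `(1 ⊕ α) s₀ ⋯ sₘ₋₁` gives a word for `α`, and the
wire ends at position `m`. -/
theorem wire_of_isWordFor {a m : ℕ} {α : Equiv.Perm (Fin a)} (hm : m ≤ a) {w : List ℕ}
    (hw : IsWordFor (shiftHom a α * wordProd (a + 1) (List.range' 0 m)) w) :
    IsWordFor α (wireErase 0 w) ∧ wirePos 0 w = m := by
  obtain ⟨hl, hp⟩ := hw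
  have hl' : ∀ i ∈ w, i < a := fun i hi => Nat.lt_of_succ_lt_succ (hl i hi)
  change wordProd (a + 1) w = _ at hp
  have key := wordProd_wire (Nat.zero_le a) hl'
  have hle := wirePos_le (Nat.zero_le a) hl'
  rw [List.range'_zero, List.nil_append, hp] at key
  have run_zero : ∀ l (h : l ≤ a), wordProd (a + 1) (List.range' 0 l) ⟨l, by omega⟩ = 0 := by
    intro l h
    ext
    rw [wordProd_run_val (by omega)]
    simp
  -- Both positions are the preimage of the value `0`.
  have hpos : wirePos 0 w = m := by
    have h₁ : (shiftHom a α * wordProd (a + 1) (List.range' 0 m)) ⟨m, by omega⟩ = 0 := by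
      rw [Equiv.Perm.mul_apply, run_zero m hm, shiftHom_zero]
    have h₂ : (shiftHom a α * wordProd (a + 1) (List.range' 0 m)) ⟨wirePos 0 w, by omega⟩ = 0 := by
      rw [key, Equiv.Perm.mul_apply, run_zero _ hle, shiftHom_zero]
    simpa using (Equiv.injective _ (h₁.trans h₂.symm)).symm
  rw [hpos] at key
  exact ⟨⟨lt_of_mem_wireErase (Nat.zero_le a) hl',
    (shiftHom_injective a (mul_right_cancel key)).symm⟩, hpos⟩

theorem isWordFor_low {a m : ℕ} {α : Equiv.Perm (Fin a)} (hm : m ≤ a) {u : List ℕ}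
    (hu : IsWordFor α u) :
    IsWordFor (shiftHom a α * wordProd (a + 1) (List.range' 0 m))
      (u.map (· + 1) ++ List.range' 0 m) := by
  refine ⟨?_, ?_⟩
  · simp only [List.mem_append, List.mem_map, List.mem_range'_1]
    rintro i (⟨j, hj, rfl⟩ | hi)
    · have := hu.1 j hj; omega
    · omega
  · change wordProd (a + 1) _ = _
    rw [wordProd_append, ← shiftHom_wordProd hu.1]
    congr 2
    exact hu.2

/-- Any competing word loses at least `m` letters when its wire is erased, and what remains is a
word for α. -/
theorem low_mem_R {a m : ℕ} {α : Equiv.Perm (Fin a)} (hm : m ≤ a) {u : List ℕ} (hu : u ∈ R α) :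
    u.map (· + 1) ++ List.range' 0 m ∈
      R (shiftHom a α * wordProd (a + 1) (List.range' 0 m)) := by
  refine ⟨isWordFor_low hm hu.1, fun w hw => ?_⟩
  obtain ⟨h₁, h₂⟩ := wire_of_isWordFor hm hw
  have h₃ := hu.2 _ h₁
  have h₄ := wire_length 0 w
  simp
  omega

/-- Comparison with the low words leaves no room for a back step or for a non-reduced erased word.
-/
theorem wire_of_mem_R {a m : ℕ} {α : Equiv.Perm (Fin a)} (hm : m ≤ a) {w : List ℕ}
    (hw : w ∈ R (shiftHom a α * wordProd (a + 1) (List.range' 0 m))) :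
    wireErase 0 w ∈ R α ∧ wirePos 0 w = m ∧ wireBack 0 w = 0 := by
  obtain ⟨h₁, h₂⟩ := wire_of_isWordFor hm hw.1
  have h₄ := wire_length 0 w
  have key : ∀ u, IsWordFor α u → w.length ≤ u.length + m := fun u hu => by
    simpa using hw.2 _ (isWordFor_low hm hu)
  refine ⟨⟨h₁, fun u hu => ?_⟩, h₂, ?_⟩
  · have := key u hu; omega
  · have := key _ h₁; omega

/-- Any two reduced words of a permutation are joined by commutation and long braid moves. -/
theorem exists_movePath (c b : ℕ) {n : ℕ} {π : Equiv.Perm (Fin n)} {u v : List ℕ}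
    (hu : u ∈ R π) (hv : v ∈ R π) : ∃ k, MovePath c b k u v := by
  induction n generalizing u v with
  | zero =>
    have : ∀ w ∈ R π, w = [] := fun w hw => by
      refine List.eq_nil_iff_forall_not_mem.mpr fun i hi => ?_
      have := hw.1.1 i hi
      omega
    rw [this u hu, this v hv]
    exact ⟨0, .refl _⟩
  | succ a ih =>
    have hl : ∀ i ∈ u, i < a := fun i hi => Nat.lt_of_succ_lt_succ (hu.1.1 i hi)
    -- Every permutation is a shifted one times a run of some length `m`, the position of its value
    -- `0`. Pulling both wires to the low extreme reduces the claim to one strand fewer.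
    have hπ := wordProd_wire (Nat.zero_le a) hl
    have hm := wirePos_le (Nat.zero_le a) hl
    rw [List.range'_zero, List.nil_append, show wordProd (a + 1) u = π from hu.1.2] at hπ
    generalize wirePos 0 u = m at hπ hm
    generalize wordProd a (wireErase 0 u) = α at hπ
    subst hπ
    obtain ⟨hu₁, hu₂, hu₃⟩ := wire_of_mem_R hm hu
    obtain ⟨hv₁, hv₂, hv₃⟩ := wire_of_mem_R hm hv
    obtain ⟨k, hk⟩ := ih hu₁ hv₁
    have p := MovePath.to_low c b 0 u hu₃
    have q := MovePath.to_low c b 0 v hv₃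
    rw [hu₂] at p
    rw [hv₂] at q
    exact ⟨_, (p.trans (hk.map_succ.append_right _)).trans q.symm⟩

/-! ### Diameters of weighted graphs of reduced words -/

/-- `D` is the maximal weighted distance between two reduced words of `π`, if commutation moves
cost `c` and long braid moves cost `b`. -/
def HasDiam (c b : ℕ) {n : ℕ} (π : Equiv.Perm (Fin n)) (D : ℕ) : Prop :=
  (∀ u ∈ R π, ∀ v ∈ R π, ∃ k ≤ D, MovePath c b k u v) ∧
    ∃ u ∈ R π, ∃ v ∈ R π, ∀ k, MovePath c b k u v → D ≤ k

theorem exists_hasDiam (c b : ℕ) {n : ℕ} (π : Equiv.Perm (Fin n)) : ∃ D, HasDiam c b π D := by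
  classical
  have hex : ∀ p : R π × R π, ∃ k, MovePath c b k p.1 p.2 :=
    fun p => exists_movePath c b p.1.2 p.2.2
  have := (finite_R π).to_subtype
  obtain ⟨w, hw⟩ := exists_mem_R π
  have : Nonempty (R π × R π) := ⟨⟨w, hw⟩, ⟨w, hw⟩⟩
  obtain ⟨p, hp⟩ := Finite.exists_max fun p => Nat.find (hex p)
  refine ⟨Nat.find (hex p), fun u hu v hv => ?_, p.1, p.1.2, p.2, p.2.2, fun k hk => ?_⟩
  · exact ⟨_, hp (⟨u, hu⟩, ⟨v, hv⟩), Nat.find_spec (hex (⟨u, hu⟩, ⟨v, hv⟩))⟩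
  · exact Nat.find_min' _ hk

/-- The effect of the inflation `21[α, 1]` on the weighted diameter. -/
theorem HasDiam.inflation {c b a D : ℕ} {α : Equiv.Perm (Fin a)} (h : HasDiam c b α D) :
    HasDiam c b (inflation21 α (1 : Equiv.Perm (Fin 1))) (D + ell α * (c * (a - 2) + b)) := by
  rw [inflation21_one_eq]
  obtain ⟨hle, u, hu, v, hv, huv⟩ := h
  refine ⟨fun w hw w' hw' => ?_, ?_⟩
  · obtain ⟨h₁, h₂, h₃⟩ := wire_of_mem_R le_rfl hw
    obtain ⟨h₁', h₂', h₃'⟩ := wire_of_mem_R le_rfl hw'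
    obtain ⟨k, hk, p⟩ := hle _ h₁ _ h₁'
    have low := MovePath.to_low c b 0 w h₃
    have low' := MovePath.to_low c b 0 w' h₃'
    rw [h₂] at low
    rw [h₂'] at low'
    obtain ⟨l, high, hl⟩ := MovePath.to_high c b 0 a w
      (fun i hi => Nat.lt_of_succ_lt_succ (hw.1.1 i hi)) h₃ h₂
    obtain ⟨l', high', hl'⟩ := MovePath.to_high c b 0 a w'
      (fun i hi => Nat.lt_of_succ_lt_succ (hw'.1.1 i hi)) h₃' h₂'
    rw [length_eq_ell h₁] at hl
    rw [length_eq_ell h₁'] at hl'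
    have route₁ := (low.trans (p.map_succ.append_right _)).trans low'.symm
    have route₂ := (high.trans (p.append_left _)).trans high'.symm
    -- The two routes together cost twice `k + ell α * (c * (a - 2) + b)`, so one of them is cheap
    -- enough.
    by_cases hc : wireCost c b 0 w + wireCost c b 0 w' ≤ ell α * (c * (a - 2) + b)
    · exact ⟨_, by omega, route₁⟩
    · exact ⟨_, by omega, route₂⟩
  · have hu' := low_mem_R le_rfl hu
    have hv' := low_mem_R le_rfl hv
    obtain ⟨e₁, e₂, e₃, e₄⟩ := wire_high c b a v hv.1.1
    have p := MovePath.to_low c b a v e₂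
    rw [e₁, e₃] at p
    -- The extremal pair is the low word over `u` and the high word over `v`; the latter is reduced
    -- because moves join it to the low word over `v`.
    refine ⟨_, hu', _, p.symm.mem_R hv', fun k hk => ?_⟩
    obtain ⟨l, hl, hl'⟩ := hk.wireErase 0
    obtain ⟨r₁, r₂⟩ := wire_run_append c b 0 a v
    obtain ⟨t₁, t₂⟩ := wire_low c b a u
    rw [Nat.zero_add] at r₁ r₂
    rw [t₁, r₁, e₁] at hl
    rw [t₂, r₂, e₄, length_eq_ell hv] at hl'
    have := huv l hl
    omega

/-! ### From weighted paths to the three graphs -/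

/-- `K` is the graph of reduced words of `π` seen through `f`: walks in `K` have the lengths of
paths of moves with costs `c` and `b`. -/
structure IsModel (c b : ℕ) {n : ℕ} {π : Equiv.Perm (Fin n)} {V : Type} (K : SimpleGraph V)
    (f : R π → V) : Prop where
  surj : Function.Surjective f
  comm : ∀ u v : R π, CommutationMove u v → ∃ p : K.Walk (f u) (f v), p.length ≤ c
  braid : ∀ u v : R π, LongBraidMove u v → ∃ p : K.Walk (f u) (f v), p.length ≤ b
  fiber : ∀ u v : R π, f u = f v → MovePath c b 0 u v
  adj : ∀ u v : R π, K.Adj (f u) (f v) → ∃ k ≤ 1, MovePath c b k u v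

namespace IsModel

variable {c b n : ℕ} {π : Equiv.Perm (Fin n)} {V : Type} {K : SimpleGraph V} {f : R π → V}

theorem exists_walk (h : IsModel c b K f) {k : ℕ} {u v : List ℕ} (hu : u ∈ R π) (hv : v ∈ R π)
    (p : MovePath c b k u v) : ∃ q : K.Walk (f ⟨u, hu⟩) (f ⟨v, hv⟩), q.length ≤ k := by
  induction p with
  | refl => exact ⟨.nil, le_rfl⟩
  | comm p m ih =>
    obtain ⟨q, hq⟩ := ih hu (p.mem_R hu)
    obtain ⟨r, hr⟩ := h.comm ⟨_, p.mem_R hu⟩ ⟨_, hv⟩ m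
    exact ⟨q.append r, by rw [SimpleGraph.Walk.length_append]; omega⟩
  | braid p m ih =>
    obtain ⟨q, hq⟩ := ih hu (p.mem_R hu)
    obtain ⟨r, hr⟩ := h.braid ⟨_, p.mem_R hu⟩ ⟨_, hv⟩ m
    exact ⟨q.append r, by rw [SimpleGraph.Walk.length_append]; omega⟩

theorem exists_movePath (h : IsModel c b K f) {x y : V} (p : K.Walk x y) (u v : R π)
    (hu : f u = x) (hv : f v = y) : ∃ k ≤ p.length, MovePath c b k u v := by
  induction p generalizing u with
  | nil => exact ⟨0, le_rfl, h.fiber u v (hu.trans hv.symm)⟩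
  | @cons x z y ha p ih =>
    obtain ⟨w, rfl⟩ := h.surj z
    obtain ⟨k, hk, q⟩ := ih w rfl hv
    obtain ⟨l, hl, r⟩ := h.adj u w (hu ▸ ha)
    exact ⟨l + k, by rw [SimpleGraph.Walk.length_cons]; omega, r.trans q⟩

theorem connected (h : IsModel c b K f) : K.Connected := by
  obtain ⟨w, hw⟩ := exists_mem_R π
  have : Nonempty V := ⟨f ⟨w, hw⟩⟩
  refine ⟨fun x y => ?_⟩
  obtain ⟨u, rfl⟩ := h.surj x
  obtain ⟨v, rfl⟩ := h.surj y
  obtain ⟨k, p⟩ := ReducedWords.exists_movePath c b u.2 v.2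
  obtain ⟨q, -⟩ := h.exists_walk u.2 v.2 p
  exact ⟨q⟩

theorem diam_eq (h : IsModel c b K f) {D : ℕ} (hD : HasDiam c b π D) : K.diam = D := by
  have hconn := h.connected
  have := hconn.nonempty
  have := (finite_R π).to_subtype
  have : Finite V := Finite.of_surjective f h.surj
  -- Connectedness and finiteness keep `diam` from being the default value 0 of an infinite
  -- diameter.
  have htop := SimpleGraph.connected_iff_ediam_ne_top.mp hconn
  obtain ⟨hle, u, hu, v, hv, huv⟩ := hD
  apply le_antisymm
  · obtain ⟨x, y, hxy⟩ := K.exists_dist_eq_diam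
    obtain ⟨u, rfl⟩ := h.surj x
    obtain ⟨v, rfl⟩ := h.surj y
    obtain ⟨k, hk, p⟩ := hle u u.2 v v.2
    obtain ⟨q, hq⟩ := h.exists_walk u.2 v.2 p
    rw [← hxy]
    exact (SimpleGraph.dist_le q).trans (hq.trans hk)
  · obtain ⟨p, hp⟩ := hconn.exists_walk_length_eq_dist (f ⟨u, hu⟩) (f ⟨v, hv⟩)
    obtain ⟨k, hk, q⟩ := h.exists_movePath p ⟨u, hu⟩ ⟨v, hv⟩ rfl rfl
    exact (huv k q).trans (hk.trans (hp.le.trans (SimpleGraph.dist_le_diam htop)))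

end IsModel

variable {n : ℕ} (π : Equiv.Perm (Fin n))

theorem isModel_G : IsModel 1 1 (G π) (id : R π → R π) where
  surj := Function.surjective_id
  comm u v h := ⟨SimpleGraph.Walk.cons (Or.inl h : (G π).Adj u v) .nil, le_rfl⟩
  braid u v h := ⟨SimpleGraph.Walk.cons (Or.inr h : (G π).Adj u v) .nil, le_rfl⟩
  fiber u v h := by
    obtain rfl : u = v := h
    exact .refl _
  adj u v h := ⟨1, le_rfl, h.elim .of_comm .of_braid⟩

theorem movePath_of_reachable_commutationEdges {u v : R π}
    (h : (commutationEdges π).Reachable u v) : MovePath 0 1 0 u v := by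
  obtain ⟨p⟩ := h
  induction p with
  | nil => exact .refl _
  | cons a _ ih => exact (MovePath.of_comm a).trans ih

theorem movePath_of_reachable_longBraidEdges {u v : R π}
    (h : (longBraidEdges π).Reachable u v) : MovePath 1 0 0 u v := by
  obtain ⟨p⟩ := h
  induction p with
  | nil => exact .refl _
  | cons a _ ih => exact (MovePath.of_braid a).trans ih

theorem isModel_C : IsModel 0 1 (C π) (commutationEdges π).connectedComponentMk where
  surj := Quot.mk_surjective
  comm u v h := by
    rw [SimpleGraph.ConnectedComponent.eq.mpr
      (SimpleGraph.Adj.reachable (h : (commutationEdges π).Adj u v))]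
    exact ⟨.nil, le_rfl⟩
  braid u v h := by
    -- The contracted graph has no loops, so equal classes need the trivial walk.
    by_cases e : (commutationEdges π).connectedComponentMk u =
      (commutationEdges π).connectedComponentMk v
    · rw [e]
      exact ⟨.nil, Nat.zero_le _⟩
    · have : (C π).Adj ((commutationEdges π).connectedComponentMk u)
          ((commutationEdges π).connectedComponentMk v) := ⟨e, u, v, Or.inr h, rfl, rfl⟩
      exact ⟨SimpleGraph.Walk.cons this .nil, le_rfl⟩
  fiber u v h := movePath_of_reachable_commutationEdges π (SimpleGraph.ConnectedComponent.eq.mp h)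
  adj u v h := by
    obtain ⟨-, u', v', ha, hu, hv⟩ := h
    have p := movePath_of_reachable_commutationEdges π (SimpleGraph.ConnectedComponent.eq.mp hu)
    have q := movePath_of_reachable_commutationEdges π (SimpleGraph.ConnectedComponent.eq.mp hv)
    rcases ha with ha | ha
    · exact ⟨_, by omega, (p.symm.trans (.of_comm ha)).trans q⟩
    · exact ⟨_, by omega, (p.symm.trans (.of_braid ha)).trans q⟩

theorem isModel_B : IsModel 1 0 (B π) (longBraidEdges π).connectedComponentMk where
  surj := Quot.mk_surjective
  braid u v h := by
    rw [SimpleGraph.ConnectedComponent.eq.mpr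
      (SimpleGraph.Adj.reachable (h : (longBraidEdges π).Adj u v))]
    exact ⟨.nil, le_rfl⟩
  comm u v h := by
    by_cases e : (longBraidEdges π).connectedComponentMk u =
      (longBraidEdges π).connectedComponentMk v
    · rw [e]
      exact ⟨.nil, Nat.zero_le _⟩
    · have : (B π).Adj ((longBraidEdges π).connectedComponentMk u)
          ((longBraidEdges π).connectedComponentMk v) := ⟨e, u, v, Or.inl h, rfl, rfl⟩
      exact ⟨SimpleGraph.Walk.cons this .nil, le_rfl⟩
  fiber u v h := movePath_of_reachable_longBraidEdges π (SimpleGraph.ConnectedComponent.eq.mp h)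
  adj u v h := by
    obtain ⟨-, u', v', ha, hu, hv⟩ := h
    have p := movePath_of_reachable_longBraidEdges π (SimpleGraph.ConnectedComponent.eq.mp hu)
    have q := movePath_of_reachable_longBraidEdges π (SimpleGraph.ConnectedComponent.eq.mp hv)
    rcases ha with ha | ha
    · exact ⟨_, by omega, (p.symm.trans (.of_comm ha)).trans q⟩
    · exact ⟨_, by omega, (p.symm.trans (.of_braid ha)).trans q⟩

/-- Makes the truncated `a - 2` agree with integer subtraction; if the length is zero, its factor
kills the term. -/
theorem two_le_of_ell_ne_zero (h : ell π ≠ 0) : 2 ≤ n := by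
  obtain ⟨w, hw⟩ := exists_mem_R π
  rw [← length_eq_ell hw] at h
  obtain ⟨i, hi⟩ := List.exists_mem_of_ne_nil w (by rintro rfl; exact h rfl)
  have := hw.1.1 i hi
  omega

end ReducedWords

theorem corollary4p7 (a : ℕ) (α : Equiv.Perm (Fin a)) (π : Equiv.Perm (Fin (a + 1)))
    (hπ : π = ReducedWords.inflation21 α (1 : Equiv.Perm (Fin 1))) :
    -- all the graphs are connected, so that `diam` is the maximum of the distances
    ((ReducedWords.G α).Connected ∧ (ReducedWords.C α).Connected ∧ (ReducedWords.B α).Connected ∧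
      (ReducedWords.G π).Connected ∧ (ReducedWords.C π).Connected ∧
      (ReducedWords.B π).Connected) ∧
    ((ReducedWords.G π).diam : ℤ) =
      (ReducedWords.G α).diam + (ReducedWords.ell α : ℤ) * ((a : ℤ) - 1) ∧
    (ReducedWords.C π).diam = (ReducedWords.C α).diam + ReducedWords.ell α ∧
    ((ReducedWords.B π).diam : ℤ) =
      (ReducedWords.B α).diam + (ReducedWords.ell α : ℤ) * ((a : ℤ) - 2) := by
  open ReducedWords in
  subst hπ
  refine ⟨⟨(isModel_G _).connected, (isModel_C _).connected, (isModel_B _).connected,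
    (isModel_G _).connected, (isModel_C _).connected, (isModel_B _).connected⟩, ?_, ?_, ?_⟩
  · obtain ⟨D, hD⟩ := exists_hasDiam 1 1 α
    rw [(isModel_G _).diam_eq hD, (isModel_G _).diam_eq hD.inflation]
    by_cases h : ell α = 0
    · simp [h]
    · have := two_le_of_ell_ne_zero α h
      push_cast [Nat.cast_sub this]
      ring
  · obtain ⟨D, hD⟩ := exists_hasDiam 0 1 α
    rw [(isModel_C _).diam_eq hD, (isModel_C _).diam_eq hD.inflation]
    ring
  · obtain ⟨D, hD⟩ := exists_hasDiam 1 0 α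
    rw [(isModel_B _).diam_eq hD, (isModel_B _).diam_eq hD.inflation]
    by_cases h : ell α = 0
    · simp [h]
    · have := two_le_of_ell_ne_zero α h
      push_cast [Nat.cast_sub this]
      ring
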